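/- Let $0<m\le M$, $\Delta>0$, $\theta=M/m$. Let $\mathcal G$ be a nonempty family of pairs $(p,f)$ with $p\in[m,M]$ and $f:[0,\Delta]\to[0,\infty)$ convex and continuous with $f(0)=0$; for instance all such pairs, or all those for which the revenue function $g(v)=(p-f(v))v$ is differentiable and increasing on $[0,\Delta]$. An input $\sigma$ is a finite sequence $(p(t),f_t)_{t=1}^{T}$ in $\mathcal G$, $T\ge1$, revealed one slot at a time with $T$ unknown; selling the quantity $v$ in slot $t$ earns $g_t(v)=(p(t)-f_t(v))v$. Let $\eta_{OPT}(\sigma^{[1:t]})$ be the maximum of $\sum_{s\le t}g_s(v_s)$ over $v_s\ge0$ with $\sum_{s\le t}v_s\le\Delta$ (it is $0$ for $t=0$). For $\pi\ge1$, CR-Pursuit$(\pi)$ is the deterministic online algorithm that in slot $t$ sells a quantity $\bar v_t\in[0,\Delta]$ with $$g_t(\bar v_t)=\frac1\pi\left[\eta_{OPT}(\sigma^{[1:t]})-\eta_{OPT}(\sigma^{[1:t-1]})\right],$$ where $\bar v_t$ is taken on the increasing branch of $g_t$, i.e. $g_t$ is nondecreasing on $[0,\bar v_t]$ (this is automatic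 if $g_t$ is increasing on $[0,\Delta]$). An online algorithm is feasible if the supremum $\Phi_\Delta$ over all inputs of the total quantity it sells is at most $\Delta$; it is $\pi$-competitive if on every input it sells nonnegative quantities of total at most $\Delta$ and earns a positive revenue, and $\pi$ is the maximum over all inputs of the ratio of $\eta_{OPT}(\sigma)$ to its revenue. Let $\bar\pi=\dfrac{(\ln\theta+1)^2}{\ln\theta+3/4}$. Then: 1. $\bar\pi\le\ln\theta+\frac43$, with strict inequality if $\theta>1$; moreover $\bar\pi\ge1$. 2. For every $\pi\ge1$, CR-Pursuit$(\pi)$ exists (the required $\bar v_t$ can always be found), and on every input its quantities satisfy $\displaystyle \bar v_t\le\frac{2}{1+\sqrt{1-1/\pi}}\cdot\frac{g_t(\bar v_t)}{p(t)}$ for all $t$. 3. CR-Pursuit$(\bar\pi)$ is feasible and $\bar\pi$-competitive. -/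

import Mathlib

namespace OneWayTrading

noncomputable section

/-- What is revealed to the trader at one time slot: the base price `p` and the price elasticity
`f`, a function of the quantity sold in that slot (only its values on `[0, Δ]` matter). -/
structure Slot where
  price : ℝ
  elasticity : ℝ → ℝ

/-- The revenue function of a slot, `g(v) = (p - f(v)) v`. -/
def Slot.revenue (s : Slot) (v : ℝ) : ℝ := (s.price - s.elasticity v) * v

/-- All slots with base price in `[m, M]` and a convex, nonnegative, continuous price elasticity
on `[0, Δ]` that vanishes at `0`. (A convex `f` for which `g` is differentiable on `[0, Δ]` is
continuous there.) The revenue function need not be increasing on `[0, Δ]`. -/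
def elasticSlots (m M Δ : ℝ) : Set Slot :=
  {s | s.price ∈ Set.Icc m M ∧
    ConvexOn ℝ (Set.Icc 0 Δ) s.elasticity ∧
    ContinuousOn s.elasticity (Set.Icc 0 Δ) ∧
    (∀ v ∈ Set.Icc 0 Δ, 0 ≤ s.elasticity v) ∧
    s.elasticity 0 = 0}

/-- The slots `σ 0, …, σ (T - 1)` form an input of length `T ≥ 1` from the family `𝒢`
(the later values of `σ` play no role). -/
def IsInput (𝒢 : Set Slot) (σ : ℕ → Slot) (T : ℕ) : Prop :=
  1 ≤ T ∧ ∀ t < T, σ t ∈ 𝒢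

/-- The optimal offline revenue `η_OPT(σ^[1:T])` under the inventory constraint: the maximum of
`∑ g_t(v_t)` over `v ≥ 0` with `∑ v_t ≤ Δ`. It is `0` for `T = 0`. -/
def opt (Δ : ℝ) (σ : ℕ → Slot) (T : ℕ) : ℝ :=
  sSup {r | ∃ v : ℕ → ℝ, (∀ t < T, 0 ≤ v t) ∧ ∑ t ∈ Finset.range T, v t ≤ Δ ∧
    r = ∑ t ∈ Finset.range T, (σ t).revenue (v t)}

/-- A deterministic online algorithm: the quantity sold in slot `t` is a function of the slots
`0, …, t` revealed so far (neither of the later slots nor of the number of slots). -/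
abbrev OnlineAlgorithm := (t : ℕ) → (Fin (t + 1) → Slot) → ℝ

/-- The quantity that the algorithm sells in slot `t` under the input `σ`. -/
def OnlineAlgorithm.action (A : OnlineAlgorithm) (σ : ℕ → Slot) (t : ℕ) : ℝ :=
  A t (fun i => σ i)

/-- The revenue `η_A(σ)` of the algorithm on the first `T` slots. -/
def OnlineAlgorithm.totalRevenue (A : OnlineAlgorithm) (σ : ℕ → Slot) (T : ℕ) : ℝ :=
  ∑ t ∈ Finset.range T, (σ t).revenue (A.action σ t)

/-- `A` is an implementation of CR-Pursuit(`π`) on the family `𝒢`: in every slot it sells a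
quantity `v ∈ [0, Δ]` with `g_t(v) = (η_OPT(σ^[1:t]) - η_OPT(σ^[1:t-1])) / π`.
The last clause places `v` on the increasing branch of `g_t`. It holds automatically when `g_t` is
increasing on `[0, Δ]`; otherwise the equation can have a second, larger root beyond the
maximizer of `g_t`, which is not used. -/
def IsCRPursuit (𝒢 : Set Slot) (Δ π : ℝ) (A : OnlineAlgorithm) : Prop :=
  ∀ (σ : ℕ → Slot) (T : ℕ), IsInput 𝒢 σ T → ∀ t < T,
    A.action σ t ∈ Set.Icc 0 Δ ∧
    (σ t).revenue (A.action σ t) = 1 / π * (opt Δ σ (t + 1) - opt Δ σ t) ∧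
    MonotoneOn (σ t).revenue (Set.Icc 0 (A.action σ t))

/-- The worst-case inventory `Φ_Δ` that the algorithm sells, over all inputs from `𝒢`
(a supremum in the extended reals, so it is `⊤` when unbounded). -/
def worstCaseInventory (𝒢 : Set Slot) (A : OnlineAlgorithm) : EReal :=
  ⨆ (σ : ℕ → Slot) (T : ℕ) (_ : IsInput 𝒢 σ T),
    ((∑ t ∈ Finset.range T, A.action σ t : ℝ) : EReal)

/-- The algorithm is feasible: its worst-case inventory is at most `Δ`. -/
def IsFeasible (𝒢 : Set Slot) (Δ : ℝ) (A : OnlineAlgorithm) : Prop :=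
  worstCaseInventory 𝒢 A ≤ (Δ : EReal)

/-- The algorithm is `π`-competitive on the family `𝒢`: on every input its quantities are
nonnegative, respect the inventory constraint and earn a positive revenue, and `π` is the maximum
over all inputs of the offline-to-online revenue ratio. -/
def IsCompetitive (𝒢 : Set Slot) (Δ π : ℝ) (A : OnlineAlgorithm) : Prop :=
  (∀ (σ : ℕ → Slot) (T : ℕ), IsInput 𝒢 σ T →
    (∀ t < T, 0 ≤ A.action σ t) ∧ ∑ t ∈ Finset.range T, A.action σ t ≤ Δ ∧
      0 < A.totalRevenue σ T) ∧
  IsGreatest {r : ℝ | ∃ (σ : ℕ → Slot) (T : ℕ), IsInput 𝒢 σ T ∧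
    r = opt Δ σ T / A.totalRevenue σ T} π

/-- `π̄ = (ln θ + 1)² / (ln θ + 3/4)`. -/
def pursuitRatio (θ : ℝ) : ℝ := (Real.log θ + 1) ^ 2 / (Real.log θ + 3 / 4)

end

end OneWayTrading

open OneWayTrading

namespace OneWayTrading

open Finset

/-! Let `δ_t` be the increment of the offline optimum in slot `t`. Revenues telescope to `1/π` times
the optimum, so every input has ratio exactly `π`; the issue is inventory. Convexity of `f` bounds
each quantity by a constant times `δ_t / (π p_t)` (`le_revenue_div_price`), and for `π̄` this is
`δ_t / ((ln θ + 1) p_t)`. It remains to show `∑ δ_t / p_t ≤ Δ (ln θ + 1)`. The offline optimum is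
submodular in the set of available slots (`optOn_insert_add_le`), hence the increments over any set
of slots of price at most `q` sum to at most `q Δ`. Summation in order of price (`sum_div_price_le`)
turns these bounds into the logarithm. -/

/-- The offline revenues attainable when only the slots in `S` may be used. -/
def offlineRevenues (Δ : ℝ) (σ : ℕ → Slot) (S : Finset ℕ) : Set ℝ :=
  {r | ∃ v : ℕ → ℝ, (∀ t ∈ S, 0 ≤ v t) ∧ ∑ t ∈ S, v t ≤ Δ ∧
    r = ∑ t ∈ S, (σ t).revenue (v t)}

/-- The optimal offline revenue when only the slots in `S` may be used. -/
noncomputable def optOn (Δ : ℝ) (σ : ℕ → Slot) (S : Finset ℕ) : ℝ :=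
  sSup (offlineRevenues Δ σ S)

theorem opt_eq_optOn_range (Δ : ℝ) (σ : ℕ → Slot) (T : ℕ) :
    opt Δ σ T = optOn Δ σ (range T) := by
  simp only [opt, optOn, offlineRevenues, mem_range]

theorem opt_congr {Δ : ℝ} {σ τ : ℕ → Slot} {T : ℕ} (h : ∀ i < T, σ i = τ i) :
    opt Δ σ T = opt Δ τ T := by
  unfold opt
  congr 1
  ext r
  have key : ∀ v : ℕ → ℝ, ∑ t ∈ range T, (σ t).revenue (v t) =
      ∑ t ∈ range T, (τ t).revenue (v t) := fun v =>
    sum_congr rfl fun i hi => by rw [h i (mem_range.1 hi)]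
  simp only [Set.mem_ofPred_eq, key]

/-! ### Revenue of a single slot -/

section Slot

variable {m M Δ : ℝ} {s : Slot}

theorem Slot.revenue_zero (s : Slot) : s.revenue 0 = 0 := by simp [Slot.revenue]

/-- Convexity and `f 0 = 0` make `f v / v` nondecreasing; the product form also covers `x = 0`. -/
theorem elasticity_smul_le (hs : s ∈ elasticSlots m M Δ) {x y : ℝ} (hx : 0 ≤ x) (hxy : x ≤ y)
    (hy : y ≤ Δ) : s.elasticity x * y ≤ s.elasticity y * x := by
  obtain ⟨-, hconv, -, -, h0⟩ := hs
  rcases hx.eq_or_lt with rfl | hx'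
  · simp [h0]
  have hy0 : 0 < y := hx'.trans_le hxy
  have h := hconv.2 (⟨le_rfl, hy0.le.trans hy⟩ : (0 : ℝ) ∈ Set.Icc 0 Δ)
    (⟨hy0.le, hy⟩ : y ∈ Set.Icc 0 Δ)
    (by rw [sub_nonneg, div_le_one hy0]; exact hxy : (0 : ℝ) ≤ 1 - x / y)
    (by positivity : (0 : ℝ) ≤ x / y) (by ring)
  simp only [smul_eq_mul, mul_zero, zero_add, h0] at h
  rw [div_mul_cancel₀ _ hy0.ne'] at h
  calc s.elasticity x * y ≤ (x / y * s.elasticity y) * y := by gcongr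
    _ = s.elasticity y * x := by field_simp

theorem elasticity_monotoneOn (hs : s ∈ elasticSlots m M Δ) :
    MonotoneOn s.elasticity (Set.Icc 0 Δ) := by
  intro x hx y hy hxy
  rcases (hx.1.trans hxy).eq_or_lt with h | h
  · have : x = y := by linarith [hx.1]
    rw [this]
  have h1 := elasticity_smul_le hs hx.1 hxy hy.2
  have h2 : s.elasticity y * x ≤ s.elasticity y * y :=
    mul_le_mul_of_nonneg_left hxy (hs.2.2.2.1 y hy)
  exact le_of_mul_le_mul_right (h1.trans h2) h

theorem revenue_concaveOn (hs : s ∈ elasticSlots m M Δ) :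
    ConcaveOn ℝ (Set.Icc 0 Δ) s.revenue := by
  have hcost : ConvexOn ℝ (Set.Icc 0 Δ) (s.elasticity * (fun v : ℝ => v)) := by
    refine hs.2.1.mul (convexOn_id (convex_Icc 0 Δ)) (fun v hv => hs.2.2.2.1 v hv)
      (fun v hv => hv.1) ?_
    intro x hx y hy hxy
    exact elasticity_monotoneOn hs hx hy (le_of_lt hxy)
  refine ⟨convex_Icc 0 Δ, fun x hx y hy a b ha hb hab => ?_⟩
  have h := hcost.2 hx hy ha hb hab
  simp only [Pi.mul_apply, smul_eq_mul] at h
  simp only [Slot.revenue, smul_eq_mul]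
  linarith

theorem revenue_continuousOn (hs : s ∈ elasticSlots m M Δ) :
    ContinuousOn s.revenue (Set.Icc 0 Δ) :=
  (continuousOn_const.sub hs.2.2.1).mul continuousOn_id

theorem revenue_le_price_mul (hs : s ∈ elasticSlots m M Δ) {v : ℝ} (hv : v ∈ Set.Icc 0 Δ) :
    s.revenue v ≤ s.price * v :=
  mul_le_mul_of_nonneg_right (by linarith [hs.2.2.2.1 v hv]) hv.1

theorem exists_revenue_pos (hm : 0 < m) (hΔ : 0 < Δ) (hs : s ∈ elasticSlots m M Δ) :
    ∃ v ∈ Set.Icc 0 Δ, 0 < s.revenue v := by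
  have hc : ContinuousWithinAt s.elasticity (Set.Ioc 0 Δ) 0 :=
    (hs.2.2.1 0 ⟨le_rfl, hΔ.le⟩).mono Set.Ioc_subset_Icc_self
  have hp : s.elasticity 0 < s.price := by rw [hs.2.2.2.2]; linarith [hs.1.1]
  have hev := hc.eventually (gt_mem_nhds hp)
  have hne : (nhdsWithin (0 : ℝ) (Set.Ioc 0 Δ)).NeBot := by
    rw [nhdsWithin_Ioc_eq_nhdsGT hΔ]; infer_instance
  obtain ⟨v, hv, hv'⟩ := (hev.and self_mem_nhdsWithin).exists
  exact ⟨v, Set.Ioc_subset_Icc_self hv', mul_pos (by linarith) hv'.1⟩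

/-- A value between `0` and the peak revenue is taken on the increasing branch. -/
theorem exists_revenue_eq_monotoneOn (hs : s ∈ elasticSlots m M Δ) {x c : ℝ}
    (hc : 0 ≤ c) (hx : x ∈ Set.Icc 0 Δ) (hcx : c ≤ s.revenue x)
    (hmax : IsMaxOn s.revenue (Set.Icc 0 Δ) x) :
    ∃ v ∈ Set.Icc 0 Δ, s.revenue v = c ∧ MonotoneOn s.revenue (Set.Icc 0 v) := by
  have hsub : Set.Icc 0 x ⊆ Set.Icc 0 Δ := Set.Icc_subset_Icc_right hx.2
  have hmono : MonotoneOn s.revenue (Set.Icc 0 x) := by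
    intro a ha b hb hab
    have h := (revenue_concaveOn hs).min_le_of_mem_Icc (hsub ha) hx ⟨hab, hb.2⟩
    rwa [min_eq_left (hmax (hsub ha))] at h
  obtain ⟨v, hv, hvc⟩ := intermediate_value_Icc hx.1 ((revenue_continuousOn hs).mono hsub)
    (show c ∈ Set.Icc (s.revenue 0) (s.revenue x) from ⟨by rwa [s.revenue_zero], hcx⟩)
  exact ⟨v, hsub hv, hvc, hmono.mono (Set.Icc_subset_Icc_right hv.2)⟩

/-- A quantity on the increasing branch that earns at most the fraction `1 / π` of an attainable
revenue is sold at a good average price. -/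
theorem le_revenue_div_price (hm : 0 < m) (hs : s ∈ elasticSlots m M Δ) {π x y : ℝ}
    (hπ : 1 ≤ π) (hx : x ∈ Set.Icc 0 Δ) (hy : y ∈ Set.Icc 0 Δ)
    (hmono : MonotoneOn s.revenue (Set.Icc 0 x)) (hxy : π * s.revenue x ≤ s.revenue y) :
    x ≤ 2 * (1 + Real.sqrt (1 - 1 / π))⁻¹ * (s.revenue x / s.price) := by
  have hp : 0 < s.price := hm.trans_le hs.1.1
  have hπ0 : 0 < π := by linarith
  rcases hx.1.eq_or_lt with rfl | hx0
  · simp [s.revenue_zero]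
  set p := s.price with hpdef
  set a := s.elasticity x with hadef
  have ha : 0 ≤ a := hs.2.2.2.1 x hx
  have hgx : s.revenue x = (p - a) * x := rfl
  have hap : 2 * a ≤ p := by
    by_contra! hcon
    have ha0 : 0 < a := by linarith
    -- On `[0, x]` the graph of `f` lies below its chord, so `g` lies above the parabola `(p - a v /
    -- x) v`. If `2 a > p`, its vertex is left of `x` and `g` would have to decrease after it.
    set v := x * (p / (2 * a)) with hv
    have hv1 : p / (2 * a) ≤ 1 := by rw [div_le_one (by positivity)]; exact hcon.le
    have hv0 : 0 < v := by positivity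
    have hvx : v ≤ x := mul_le_of_le_one_right hx0.le hv1
    have h1 := hmono ⟨hv0.le, hvx⟩ ⟨hx0.le, le_rfl⟩ hvx
    have h2 := elasticity_smul_le hs hv0.le hvx hx.2
    have h3 : 2 * a * v = x * p := by rw [hv]; field_simp
    have h4 : s.elasticity v ≤ p / 2 := by
      refine le_of_mul_le_mul_right (h2.trans (le_of_eq ?_)) hx0
      linarith
    have h5 : p / 2 * v ≤ s.revenue v := by
      unfold Slot.revenue
      exact mul_le_mul_of_nonneg_right (by linarith) hv0.le
    have h6 : p / 2 * v ≤ (p - a) * x := h5.trans (h1.trans_eq hgx)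
    have h7 : (p - 2 * a) ^ 2 * x ≤ 0 := by nlinarith
    have h8 : 0 < (p - 2 * a) ^ 2 * x := mul_pos (sq_pos_of_neg (by linarith)) hx0
    linarith
  -- For `y ≥ x`, `f` lies above the extended chord, so `g y` is at most the vertex value `p² x / (4
  -- a)` (if `a > 0`). For `y ≤ x`, monotonicity already forces `π (p - a) ≤ p - a`.
  have hquad : π * (4 * a * (p - a)) ≤ p ^ 2 := by
    rcases le_total x y with h | h
    · have h1 := elasticity_smul_le hs hx0.le h hy.2
      have h2 : s.revenue y * x ≤ (p * x - a * y) * y := by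
        have : s.revenue y * x = (p * x - s.elasticity y * x) * y := by
          simp only [Slot.revenue]; ring
        rw [this]
        exact mul_le_mul_of_nonneg_right (by linarith) hy.1
      have h3 : π * (p - a) * x ^ 2 ≤ (p * x - a * y) * y := by
        calc π * (p - a) * x ^ 2 = π * s.revenue x * x := by rw [hgx]; ring
          _ ≤ s.revenue y * x := by gcongr
          _ ≤ _ := h2
      have h4 : π * (4 * a * (p - a)) * x ^ 2 ≤ p ^ 2 * x ^ 2 := by
        have h5 := mul_le_mul_of_nonneg_left h3 (by linarith : 0 ≤ 4 * a)
        nlinarith [sq_nonneg (p * x - 2 * a * y)]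
      exact le_of_mul_le_mul_right h4 (by positivity)
    · have h1 := hmono ⟨hy.1, h⟩ ⟨hx0.le, le_rfl⟩ h
      have h2 : (π * (p - a)) * x ≤ (p - a) * x := by
        rw [mul_assoc, ← hgx]; exact hxy.trans h1
      have h3 := le_of_mul_le_mul_right h2 hx0
      have h4 := mul_le_mul_of_nonneg_left h3 (by linarith : 0 ≤ 4 * a)
      nlinarith [sq_nonneg (p - 2 * a)]
  -- Solve the quadratic inequality for `a / p`; `2 a ≤ p` selects the root.
  have hrt : Real.sqrt (1 - 1 / π) ≤ (p - 2 * a) / p := by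
    apply Real.sqrt_le_iff.2
    refine ⟨by apply div_nonneg _ hp.le; linarith, ?_⟩
    have h1 : 4 * a * (p - a) ≤ p ^ 2 / π := by
      rw [le_div_iff₀ hπ0]; linarith
    rw [div_pow, le_div_iff₀ (by positivity)]
    calc (1 - 1 / π) * p ^ 2 = p ^ 2 - p ^ 2 / π := by ring
      _ ≤ (p - 2 * a) ^ 2 := by linarith
  set r := Real.sqrt (1 - 1 / π) with hr
  have hr0 : 0 ≤ r := Real.sqrt_nonneg _
  rw [le_div_iff₀ hp] at hrt
  rw [hgx]
  have : 2 * (1 + r)⁻¹ * ((p - a) * x / p) = (2 * ((p - a) * x)) / ((1 + r) * p) := by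
    field_simp
  rw [this, le_div_iff₀ (by positivity)]
  nlinarith

end Slot

/-! ### The offline optimum and its diminishing returns -/

section Opt

variable {m M Δ : ℝ} {σ : ℕ → Slot} {S : Finset ℕ}

theorem mem_Icc_of_sum_le {v : ℕ → ℝ} (h0 : ∀ t ∈ S, 0 ≤ v t) (h : ∑ t ∈ S, v t ≤ Δ)
    {t : ℕ} (ht : t ∈ S) : v t ∈ Set.Icc 0 Δ :=
  ⟨h0 t ht, (single_le_sum h0 ht).trans h⟩

theorem offlineRevenues_le {P r : ℝ} (hP : 0 ≤ P) (hσ : ∀ t ∈ S, σ t ∈ elasticSlots m M Δ)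
    (hp : ∀ t ∈ S, (σ t).price ≤ P) (hr : r ∈ offlineRevenues Δ σ S) : r ≤ P * Δ := by
  obtain ⟨v, h0, hsum, rfl⟩ := hr
  calc ∑ t ∈ S, (σ t).revenue (v t) ≤ ∑ t ∈ S, P * v t := sum_le_sum fun t ht =>
        (revenue_le_price_mul (hσ t ht) (mem_Icc_of_sum_le h0 hsum ht)).trans
          (mul_le_mul_of_nonneg_right (hp t ht) (h0 t ht))
    _ = P * ∑ t ∈ S, v t := by rw [mul_sum]
    _ ≤ P * Δ := by gcongr

theorem zero_mem_offlineRevenues (hΔ : 0 ≤ Δ) : 0 ∈ offlineRevenues Δ σ S :=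
  ⟨fun _ => 0, fun _ _ => le_rfl, by simpa using hΔ, by simp [Slot.revenue_zero]⟩

theorem bddAbove_offlineRevenues (hM : 0 ≤ M) (hσ : ∀ t ∈ S, σ t ∈ elasticSlots m M Δ) :
    BddAbove (offlineRevenues Δ σ S) :=
  ⟨M * Δ, fun _ hr => offlineRevenues_le hM hσ (fun t ht => (hσ t ht).1.2) hr⟩

theorem optOn_le_mul {P : ℝ} (hΔ : 0 ≤ Δ) (hP : 0 ≤ P)
    (hσ : ∀ t ∈ S, σ t ∈ elasticSlots m M Δ) (hp : ∀ t ∈ S, (σ t).price ≤ P) :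
    optOn Δ σ S ≤ P * Δ :=
  csSup_le ⟨0, zero_mem_offlineRevenues hΔ⟩ fun _ hr => offlineRevenues_le hP hσ hp hr

theorem le_optOn (hM : 0 ≤ M) (hσ : ∀ t ∈ S, σ t ∈ elasticSlots m M Δ) {v : ℕ → ℝ}
    (h0 : ∀ t ∈ S, 0 ≤ v t) (h : ∑ t ∈ S, v t ≤ Δ) :
    ∑ t ∈ S, (σ t).revenue (v t) ≤ optOn Δ σ S :=
  le_csSup (bddAbove_offlineRevenues hM hσ) ⟨v, h0, h, rfl⟩

theorem optOn_empty (hΔ : 0 ≤ Δ) : optOn Δ σ ∅ = 0 := by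
  have : offlineRevenues Δ σ ∅ = {0} := by
    ext r; simp [offlineRevenues, hΔ]
  rw [optOn, this, csSup_singleton]

/-- An exchange between two allocations: sharing concave revenues between two agents whose
total allowance is that of the given allocations. -/
theorem exists_exchange (hσ : ∀ t ∈ S, σ t ∈ elasticSlots m M Δ) {x y : ℕ → ℝ} {c d : ℝ}
    (hx : ∀ t ∈ S, x t ∈ Set.Icc 0 Δ) (hy : ∀ t ∈ S, y t ∈ Set.Icc 0 Δ)
    (hxc : ∑ t ∈ S, x t ≤ c) (hxd : ∑ t ∈ S, x t ≤ d)
    (hxy : ∑ t ∈ S, x t + ∑ t ∈ S, y t ≤ c + d) :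
    ∃ z w : ℕ → ℝ, (∀ t ∈ S, 0 ≤ z t) ∧ (∀ t ∈ S, 0 ≤ w t) ∧
      ∑ t ∈ S, z t ≤ c ∧ ∑ t ∈ S, w t ≤ d ∧
      ∑ t ∈ S, (σ t).revenue (x t) + ∑ t ∈ S, (σ t).revenue (y t) ≤
        ∑ t ∈ S, (σ t).revenue (z t) + ∑ t ∈ S, (σ t).revenue (w t) := by
  set X := ∑ t ∈ S, x t with hX
  set Y := ∑ t ∈ S, y t with hY
  rcases le_or_gt Y d with hYd | hYd
  · exact ⟨x, y, fun t ht => (hx t ht).1, fun t ht => (hy t ht).1, hxc, hYd, le_rfl⟩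
  have hYX : 0 < Y - X := by linarith
  -- This weight makes the total of `w` exactly `d`; the total of `z` is then `X + Y - d ≤ c`.
  set l := (d - X) / (Y - X) with hl
  have hl0 : 0 ≤ l := div_nonneg (by linarith) hYX.le
  have hl1 : 0 ≤ 1 - l := by
    rw [sub_nonneg, hl, div_le_one hYX]; linarith
  have hlX : l * (Y - X) = d - X := div_mul_cancel₀ _ hYX.ne'
  refine ⟨fun t => l * x t + (1 - l) * y t, fun t => (1 - l) * x t + l * y t,
    fun t ht => ?_, fun t ht => ?_, ?_, ?_, ?_⟩
  · have := (hx t ht).1; have := (hy t ht).1; positivity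
  · have := (hx t ht).1; have := (hy t ht).1; positivity
  · rw [sum_add_distrib, ← mul_sum, ← mul_sum, ← hX, ← hY]; linarith
  · rw [sum_add_distrib, ← mul_sum, ← mul_sum, ← hX, ← hY]; linarith
  · rw [← sum_add_distrib, ← sum_add_distrib]
    refine sum_le_sum fun t ht => ?_
    have h1 := (revenue_concaveOn (hσ t ht)).2 (hx t ht) (hy t ht) hl0 hl1 (by ring)
    have h2 := (revenue_concaveOn (hσ t ht)).2 (hx t ht) (hy t ht) hl1 hl0 (by ring)
    simp only [smul_eq_mul] at h1 h2
    linarith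

/-- The optimal offline revenue has diminishing returns in the set of available slots. -/
theorem optOn_insert_add_le (hM : 0 ≤ M) (hΔ : 0 ≤ Δ) {A B : Finset ℕ} {t : ℕ} (hAB : A ⊆ B)
    (ht : t ∉ B) (hσ : ∀ i ∈ insert t B, σ i ∈ elasticSlots m M Δ) :
    optOn Δ σ (insert t B) + optOn Δ σ A ≤ optOn Δ σ (insert t A) + optOn Δ σ B := by
  have htA : t ∉ A := fun h => ht (hAB h)
  have hσB : ∀ i ∈ B, σ i ∈ elasticSlots m M Δ := fun i hi => hσ i (mem_insert_of_mem hi)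
  have hσA : ∀ i ∈ A, σ i ∈ elasticSlots m M Δ := fun i hi => hσB i (hAB hi)
  have hσtA : ∀ i ∈ insert t A, σ i ∈ elasticSlots m M Δ :=
    fun i hi => hσ i (insert_subset_insert t hAB hi)
  suffices h : ∀ r ∈ offlineRevenues Δ σ (insert t B), ∀ q ∈ offlineRevenues Δ σ A,
      r + q ≤ optOn Δ σ (insert t A) + optOn Δ σ B by
    have h1 : ∀ q ∈ offlineRevenues Δ σ A,
        q ≤ optOn Δ σ (insert t A) + optOn Δ σ B - optOn Δ σ (insert t B) := by
      intro q hq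
      have : optOn Δ σ (insert t B) ≤ optOn Δ σ (insert t A) + optOn Δ σ B - q :=
        csSup_le ⟨0, zero_mem_offlineRevenues hΔ⟩ fun r hr => by linarith [h r hr q hq]
      linarith
    have h2 : optOn Δ σ A ≤ _ := csSup_le ⟨0, zero_mem_offlineRevenues hΔ⟩ h1
    linarith
  rintro _ ⟨x, hx0, hx, rfl⟩ _ ⟨y, hy0, hy, rfl⟩
  have hxmem : ∀ i ∈ insert t B, x i ∈ Set.Icc 0 Δ := fun i hi => mem_Icc_of_sum_le hx0 hx hi
  rw [sum_insert ht] at hx ⊢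
  rw [← sum_sdiff hAB] at hx ⊢
  have hrest : 0 ≤ ∑ i ∈ B \ A, x i := sum_nonneg fun i hi =>
    hx0 i (mem_insert_of_mem (sdiff_subset hi))
  have hxt := hx0 t (mem_insert_self t B)
  -- `x t` stays with `insert t A` and the part of `x` on `B \ A` goes to `B`. What is left of each
  -- inventory is the allowance for re-sharing `x` and `y` on `A`.
  obtain ⟨z, w, hz0, hw0, hz, hw, hzw⟩ := exists_exchange (c := Δ - x t)
    (d := Δ - ∑ i ∈ B \ A, x i) hσA
    (fun i hi => hxmem i (mem_insert_of_mem (hAB hi)))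
    (fun i hi => mem_Icc_of_sum_le hy0 hy hi) (by linarith) (by linarith) (by linarith)
  have hz' : ∑ i ∈ A, (σ i).revenue (if i = t then x t else z i) =
      ∑ i ∈ A, (σ i).revenue (z i) := sum_congr rfl fun i hi => by
    rw [if_neg (ne_of_mem_of_not_mem hi htA)]
  have hz'' : ∑ i ∈ A, (if i = t then x t else z i) = ∑ i ∈ A, z i :=
    sum_congr rfl fun i hi => by rw [if_neg (ne_of_mem_of_not_mem hi htA)]
  have h1 := le_optOn hM hσtA (v := fun i => if i = t then x t else z i) (by
    intro i hi
    split_ifs with h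
    · exact hxt
    · exact hz0 i (mem_of_mem_insert_of_ne hi h)) (by
    rw [sum_insert htA, hz'', if_pos rfl]; linarith)
  rw [sum_insert htA, hz', if_pos rfl] at h1
  have h2 := le_optOn hM hσB (v := fun i => if i ∈ A then w i else x i) (by
    intro i hi
    split_ifs with h
    · exact hw0 i h
    · exact hx0 i (mem_insert_of_mem hi)) (by
    rw [← sum_sdiff hAB, sum_congr rfl (fun i hi => if_neg (mem_sdiff.1 hi).2),
      sum_congr rfl (fun i hi => if_pos hi)]
    linarith)
  rw [← sum_sdiff hAB, sum_congr rfl (fun i hi => by rw [if_neg (mem_sdiff.1 hi).2]),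
    sum_congr (s₁ := A) rfl (fun i hi => by rw [if_pos hi])] at h2
  linarith

variable {T : ℕ}

theorem opt_zero (hΔ : 0 ≤ Δ) : opt Δ σ 0 = 0 := by
  rw [opt_eq_optOn_range, range_zero, optOn_empty hΔ]

/-- The increments of the optimal offline revenue over some of the slots are bounded by what
these slots earn on their own. -/
theorem sum_opt_increments_le (hM : 0 ≤ M) (hΔ : 0 ≤ Δ)
    (hσ : ∀ t < T, σ t ∈ elasticSlots m M Δ) (hS : S ⊆ range T) :
    ∑ t ∈ S, (opt Δ σ (t + 1) - opt Δ σ t) ≤ optOn Δ σ S := by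
  induction S using Finset.induction_on_max with
  | empty => rw [sum_empty, optOn_empty hΔ]
  | insert t S hmax ih =>
    have htS : t ∉ S := fun h => lt_irrefl _ (hmax t h)
    have ih' := ih ((subset_insert _ _).trans hS)
    have hsub : S ⊆ range t := fun i hi => mem_range.2 (hmax i hi)
    have htT : t < T := mem_range.1 (hS (mem_insert_self _ _))
    -- As `t` is the largest index, `S` lies in its past `range t`, so the increment at `t` is at
    -- most the gain from adding `t` to `S`.
    have h := optOn_insert_add_le hM hΔ hsub (notMem_range_self (n := t)) (σ := σ) (m := m)
      (fun i hi => hσ i (by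
        rcases mem_insert.1 hi with rfl | hi
        · exact htT
        · exact (mem_range.1 hi).trans htT))
    rw [sum_insert htS, opt_eq_optOn_range, opt_eq_optOn_range, range_add_one]
    linarith

theorem opt_le_opt_succ (hM : 0 ≤ M) (hΔ : 0 ≤ Δ)
    (hσ : ∀ i ≤ T, σ i ∈ elasticSlots m M Δ) : opt Δ σ T ≤ opt Δ σ (T + 1) := by
  rw [opt_eq_optOn_range, opt_eq_optOn_range]
  refine csSup_le ⟨0, zero_mem_offlineRevenues hΔ⟩ ?_
  rintro _ ⟨v, h0, hsum, rfl⟩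
  have hne : ∀ i ∈ range T, i ≠ T := fun i hi => (mem_range.1 hi).ne
  have h := le_optOn (S := range (T + 1)) hM
    (fun i hi => hσ i (Nat.lt_succ_iff.1 (mem_range.1 hi)))
    (v := fun i => if i = T then 0 else v i) (by
      intro i hi
      split_ifs with h
      · exact le_rfl
      · exact h0 i (by simp only [mem_range] at hi ⊢; omega)) (by
      rw [sum_range_succ, if_pos rfl, sum_congr rfl (fun i hi => if_neg (hne i hi))]
      linarith)
  rw [sum_range_succ, if_pos rfl, Slot.revenue_zero,
    sum_congr rfl (fun i hi => by rw [if_neg (hne i hi)])] at h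
  linarith

/-- Dropping the last slot leaves a feasible allocation. This puts the revenue that the pursuit asks
for within reach of the slot. -/
theorem opt_succ_sub_le (hM : 0 ≤ M) (hΔ : 0 ≤ Δ)
    (hσ : ∀ i ≤ T, σ i ∈ elasticSlots m M Δ) {x : ℝ}
    (hmax : IsMaxOn (σ T).revenue (Set.Icc 0 Δ) x) :
    opt Δ σ (T + 1) - opt Δ σ T ≤ (σ T).revenue x := by
  rw [sub_le_iff_le_add, opt_eq_optOn_range, opt_eq_optOn_range]
  refine csSup_le ⟨0, zero_mem_offlineRevenues hΔ⟩ ?_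
  rintro _ ⟨v, h0, hsum, rfl⟩
  have hT : T ∈ range (T + 1) := self_mem_range_succ T
  have h1 : (σ T).revenue (v T) ≤ (σ T).revenue x := hmax (mem_Icc_of_sum_le h0 hsum hT)
  have hsub : range T ⊆ range (T + 1) := range_subset_range.2 T.le_succ
  have h2 := le_optOn (S := range T) hM (fun i hi => hσ i (mem_range.1 hi).le)
    (v := v) (fun i hi => h0 i (hsub hi)) (by
      rw [sum_range_succ] at hsum
      linarith [h0 T hT])
  rw [sum_range_succ]
  linarith

theorem opt_pos (hm : 0 < m) (hM : 0 ≤ M) (hΔ : 0 < Δ) (hT : 1 ≤ T)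
    (hσ : ∀ t < T, σ t ∈ elasticSlots m M Δ) : 0 < opt Δ σ T := by
  obtain ⟨v, hv, hpos⟩ := exists_revenue_pos hm hΔ (hσ 0 hT)
  have h0 : 0 ∈ range T := mem_range.2 hT
  have h := le_optOn (S := range T) hM (fun i hi => hσ i (mem_range.1 hi))
    (v := fun i => if i = 0 then v else 0) (by
      intro i _
      split_ifs
      exacts [hv.1, le_rfl]) (by
      rw [sum_ite_eq' (range T) 0, if_pos h0]; exact hv.2)
  rw [sum_eq_single_of_mem 0 h0 (fun i _ hi => by rw [if_neg hi, Slot.revenue_zero]),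
    if_pos rfl] at h
  rw [opt_eq_optOn_range]
  linarith

end Opt

/-! ### The logarithmic bound -/

/-- If the weights of the indices of price at most `P` always sum to at most `P * Δ`, then the sum
of the quotients of weights and prices grows at most logarithmically. -/
theorem sum_div_price_le {ι : Type*} [DecidableEq ι] {m Δ P : ℝ} (hm : 0 < m) (hΔ : 0 ≤ Δ)
    {p δ : ι → ℝ} {S : Finset ι} (hmP : m ≤ P) (hp : ∀ t ∈ S, m ≤ p t)
    (hP : ∀ t ∈ S, p t ≤ P)
    (hδ : ∀ S' ⊆ S, ∀ q, m ≤ q → (∀ t ∈ S', p t ≤ q) → ∑ t ∈ S', δ t ≤ q * Δ) :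
    ∑ t ∈ S, δ t / p t ≤ Δ * Real.log (P / m) + (∑ t ∈ S, δ t) / P := by
  -- Remove an index `a` of largest price and apply the hypothesis with `P := p a`. Raising `P` from
  -- `p a` then costs `D / p a - D / P ≤ Δ (1 - p a / P) ≤ Δ log (P / p a)`, since the total weight
  -- `D` is at most `p a * Δ`.
  induction S using Finset.induction_on_max_value p generalizing P with
  | empty =>
    simp only [sum_empty, zero_div, add_zero]
    exact mul_nonneg hΔ (Real.log_nonneg ((one_le_div hm).2 hmP))
  | insert a S ha hmax ih =>
    have hsub := subset_insert a S
    have hma : m ≤ p a := hp a (mem_insert_self a S)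
    have hpa : 0 < p a := hm.trans_le hma
    have hP0 : 0 < P := hm.trans_le hmP
    have h1 := ih hma (fun t ht => hp t (hsub ht)) hmax
      (fun S' hS' => hδ S' (hS'.trans hsub))
    have h2 := hδ _ subset_rfl (p a) hma (fun t ht => by
      rcases mem_insert.1 ht with rfl | ht
      exacts [le_rfl, hmax t ht])
    have haP : p a ≤ P := hP a (mem_insert_self a S)
    rw [sum_insert ha] at h2 ⊢
    rw [sum_insert ha]
    set D := δ a + ∑ t ∈ S, δ t with hD
    have hlog : Real.log (P / m) = Real.log (p a / m) + Real.log (P / p a) := by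
      rw [← Real.log_mul (by positivity) (by positivity)]
      congr 1
      field_simp
    have h3 : 1 - p a / P ≤ Real.log (P / p a) := by
      have := Real.one_sub_inv_le_log_of_pos (show 0 < P / p a by positivity)
      rwa [inv_div] at this
    have h4 : D / p a - D / P ≤ Δ * (1 - p a / P) := by
      have e1 : D / p a - D / P = D / p a * (1 - p a / P) := by field_simp
      rw [e1]
      apply mul_le_mul_of_nonneg_right
      · rw [div_le_iff₀ hpa]; linarith
      · rw [sub_nonneg, div_le_one hP0]; exact haP
    have h5 := mul_le_mul_of_nonneg_left h3 hΔ
    have h6 : D / p a = δ a / p a + (∑ t ∈ S, δ t) / p a := add_div _ _ _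
    rw [hlog, mul_add]
    linarith

/-- Diminishing returns supply the weight bounds; the leftover `(∑ δ) / M ≤ Δ` is the source of the
`+ 1`. -/
theorem sum_opt_increments_div_price_le {m M Δ : ℝ} {σ : ℕ → Slot} {T : ℕ} (hm : 0 < m)
    (hmM : m ≤ M) (hΔ : 0 ≤ Δ) (hσ : ∀ t < T, σ t ∈ elasticSlots m M Δ) :
    ∑ t ∈ range T, (opt Δ σ (t + 1) - opt Δ σ t) / (σ t).price ≤
      Δ * (Real.log (M / m) + 1) := by
  have hM : 0 < M := hm.trans_le hmM
  have hδ : ∀ S' ⊆ range T, ∀ q, m ≤ q → (∀ t ∈ S', (σ t).price ≤ q) →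
      ∑ t ∈ S', (opt Δ σ (t + 1) - opt Δ σ t) ≤ q * Δ := fun S' hS' q hq hp =>
    (sum_opt_increments_le hM.le hΔ hσ hS').trans
      (optOn_le_mul hΔ (hm.le.trans hq) (fun t ht => hσ t (mem_range.1 (hS' ht))) hp)
  have hpM : ∀ t ∈ range T, (σ t).price ≤ M := fun t ht => (hσ t (mem_range.1 ht)).1.2
  have h := sum_div_price_le hm hΔ hmM
    (fun t ht => (hσ t (mem_range.1 ht)).1.1) hpM hδ
  have h2 := hδ _ subset_rfl M hmM hpM
  have h3 : (∑ t ∈ range T, (opt Δ σ (t + 1) - opt Δ σ t)) / M ≤ Δ := by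
    rw [div_le_iff₀ hM]; linarith
  linarith

/-! ### CR-Pursuit: existence, quantities, revenue -/

section Pursuit

variable {𝒢 : Set Slot} {m M Δ π : ℝ}

theorem exists_pursuit_quantity (hM : 0 ≤ M) (hΔ : 0 ≤ Δ) (hπ : 1 ≤ π) {σ : ℕ → Slot} {t : ℕ}
    (hσ : ∀ i ≤ t, σ i ∈ elasticSlots m M Δ) :
    ∃ v, v ∈ Set.Icc 0 Δ ∧ (σ t).revenue v = 1 / π * (opt Δ σ (t + 1) - opt Δ σ t) ∧
      MonotoneOn (σ t).revenue (Set.Icc 0 v) := by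
  obtain ⟨x, hx, hmax⟩ := isCompact_Icc.exists_isMaxOn (Set.nonempty_Icc.2 hΔ)
    (revenue_continuousOn (hσ t le_rfl))
  have h0 : 0 ≤ opt Δ σ (t + 1) - opt Δ σ t := sub_nonneg.2 (opt_le_opt_succ hM hΔ hσ)
  have h1 : 1 / π ≤ 1 := by rw [div_le_one (by linarith)]; exact hπ
  have h2 : 1 / π * (opt Δ σ (t + 1) - opt Δ σ t) ≤ (σ t).revenue x :=
    (mul_le_of_le_one_left h0 h1).trans (opt_succ_sub_le hM hΔ hσ hmax)
  exact exists_revenue_eq_monotoneOn (hσ t le_rfl) (mul_nonneg (by positivity) h0) hx h2 hmax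

/-- The extension of a nonempty finite sequence of slots by repetition of its first entry. -/
def extendSlots {t : ℕ} (h : Fin (t + 1) → Slot) (n : ℕ) : Slot :=
  if hn : n < t + 1 then h ⟨n, hn⟩ else h 0

theorem extendSlots_apply (σ : ℕ → Slot) {t i : ℕ} (hi : i < t + 1) :
    extendSlots (fun j : Fin (t + 1) => σ j) i = σ i := by
  simp [extendSlots, hi]

/-- An implementation of CR-Pursuit by choice. -/
noncomputable def crPursuit (Δ π : ℝ) : OnlineAlgorithm := fun t h =>
  -- `epsilon` needs no existence proof here, so histories outside the family get a junk value.
  Classical.epsilon fun v => v ∈ Set.Icc 0 Δ ∧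
    (extendSlots h t).revenue v =
      1 / π * (opt Δ (extendSlots h) (t + 1) - opt Δ (extendSlots h) t) ∧
    MonotoneOn (extendSlots h t).revenue (Set.Icc 0 v)

theorem isCRPursuit_crPursuit (h𝒢 : 𝒢 ⊆ elasticSlots m M Δ) (hM : 0 ≤ M) (hΔ : 0 ≤ Δ)
    (hπ : 1 ≤ π) : IsCRPursuit 𝒢 Δ π (crPursuit Δ π) := by
  intro σ T hσ t ht
  have h := Classical.epsilon_spec (exists_pursuit_quantity hM hΔ hπ (σ := σ) (t := t)
    fun i hi => h𝒢 (hσ.2 i (hi.trans_lt ht)))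
  have h1 : opt Δ (extendSlots fun j : Fin (t + 1) => σ j) (t + 1) = opt Δ σ (t + 1) :=
    opt_congr fun i hi => extendSlots_apply σ hi
  have h2 : opt Δ (extendSlots fun j : Fin (t + 1) => σ j) t = opt Δ σ t :=
    opt_congr fun i hi => extendSlots_apply σ (hi.trans t.lt_succ_self)
  simpa only [OnlineAlgorithm.action, crPursuit, h1, h2,
    extendSlots_apply σ t.lt_succ_self] using h

variable {A : OnlineAlgorithm} {σ : ℕ → Slot} {T : ℕ}

theorem IsCRPursuit.action_le (hA : IsCRPursuit 𝒢 Δ π A) (h𝒢 : 𝒢 ⊆ elasticSlots m M Δ)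
    (hm : 0 < m) (hM : 0 ≤ M) (hΔ : 0 ≤ Δ) (hπ : 1 ≤ π) (hσ : IsInput 𝒢 σ T) {t : ℕ}
    (ht : t < T) : A.action σ t ≤ 2 * (1 + Real.sqrt (1 - 1 / π))⁻¹ *
      ((σ t).revenue (A.action σ t) / (σ t).price) := by
  obtain ⟨h1, h2, h3⟩ := hA σ T hσ t ht
  have hmem : ∀ i ≤ t, σ i ∈ elasticSlots m M Δ := fun i hi => h𝒢 (hσ.2 i (hi.trans_lt ht))
  obtain ⟨x, hx, hmax⟩ := isCompact_Icc.exists_isMaxOn (Set.nonempty_Icc.2 hΔ)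
    (revenue_continuousOn (hmem t le_rfl))
  refine le_revenue_div_price hm (hmem t le_rfl) hπ h1 hx h3 ?_
  have hπ0 : π ≠ 0 := by linarith
  rw [h2, ← mul_assoc, mul_one_div_cancel hπ0, one_mul]
  exact opt_succ_sub_le hM hΔ hmem hmax

theorem IsCRPursuit.totalRevenue_eq (hA : IsCRPursuit 𝒢 Δ π A) (hΔ : 0 ≤ Δ)
    (hσ : IsInput 𝒢 σ T) : A.totalRevenue σ T = 1 / π * opt Δ σ T := by
  unfold OnlineAlgorithm.totalRevenue
  rw [sum_congr rfl fun t ht => (hA σ T hσ t (mem_range.1 ht)).2.1, ← mul_sum, sum_range_sub,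
    opt_zero hΔ, sub_zero]

theorem one_le_pursuitRatio {θ : ℝ} (hθ : 1 ≤ θ) : 1 ≤ pursuitRatio θ := by
  have hL := Real.log_nonneg hθ
  rw [pursuitRatio, one_le_div (by linarith)]
  nlinarith

/-- This identity dictates `π̄`: the per-slot constant must cancel the factor `ln θ + 1`. It works
because `1 - 1 / π̄` is the square of `(ln θ + 1/2) / (ln θ + 1)`. -/
theorem pursuitRatio_slot_factor {θ : ℝ} (hθ : 1 ≤ θ) :
    2 * (1 + Real.sqrt (1 - 1 / pursuitRatio θ))⁻¹ * (1 / pursuitRatio θ) =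
      1 / (Real.log θ + 1) := by
  have hL := Real.log_nonneg hθ
  unfold pursuitRatio
  set L := Real.log θ
  have h1 : 0 < L + 1 := by linarith
  have h2 : 0 < L + 3 / 4 := by linarith
  have h3 : 1 - 1 / ((L + 1) ^ 2 / (L + 3 / 4)) = ((L + 1 / 2) / (L + 1)) ^ 2 := by
    field_simp
    ring
  rw [h3, Real.sqrt_sq (by positivity)]
  have h4 : 1 + (L + 1 / 2) / (L + 1) = 2 * (L + 3 / 4) / (L + 1) := by
    field_simp
    ring
  rw [h4]
  field_simp

theorem IsCRPursuit.sum_action_le (hA : IsCRPursuit 𝒢 Δ (pursuitRatio (M / m)) A)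
    (h𝒢 : 𝒢 ⊆ elasticSlots m M Δ) (hm : 0 < m) (hmM : m ≤ M) (hΔ : 0 ≤ Δ)
    (hσ : IsInput 𝒢 σ T) : ∑ t ∈ range T, A.action σ t ≤ Δ := by
  have hM : 0 ≤ M := hm.le.trans hmM
  have hθ : 1 ≤ M / m := (one_le_div hm).2 hmM
  have hL : 0 < Real.log (M / m) + 1 := by linarith [Real.log_nonneg hθ]
  have h := sum_opt_increments_div_price_le hm hmM hΔ (fun t ht => h𝒢 (hσ.2 t ht))
  calc ∑ t ∈ range T, A.action σ t
      ≤ ∑ t ∈ range T, 1 / (Real.log (M / m) + 1) *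
          ((opt Δ σ (t + 1) - opt Δ σ t) / (σ t).price) := by
        refine sum_le_sum fun t ht => ?_
        have h1 := hA.action_le h𝒢 hm hM hΔ (one_le_pursuitRatio hθ) hσ (mem_range.1 ht)
        rw [(hA σ T hσ t (mem_range.1 ht)).2.1, mul_div_assoc, ← mul_assoc,
          pursuitRatio_slot_factor hθ] at h1
        exact h1
    _ = 1 / (Real.log (M / m) + 1) *
          ∑ t ∈ range T, (opt Δ σ (t + 1) - opt Δ σ t) / (σ t).price := by rw [mul_sum]
    _ ≤ 1 / (Real.log (M / m) + 1) * (Δ * (Real.log (M / m) + 1)) := by gcongr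
    _ = Δ := by field_simp

/-- After clearing the denominator, the two sides differ by `ln θ / 12`. -/
theorem pursuitRatio_le {θ : ℝ} (hθ : 1 ≤ θ) : pursuitRatio θ ≤ Real.log θ + 4 / 3 := by
  have hL := Real.log_nonneg hθ
  rw [pursuitRatio, div_le_iff₀ (by linarith)]
  nlinarith

theorem pursuitRatio_lt {θ : ℝ} (hθ : 1 < θ) : pursuitRatio θ < Real.log θ + 4 / 3 := by
  have hL := Real.log_pos hθ
  rw [pursuitRatio, div_lt_iff₀ (by linarith)]
  nlinarith

end Pursuit

end OneWayTrading

/-! ### The main theorem -/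

theorem theorem16 (m M Δ : ℝ) (hm : 0 < m) (hmM : m ≤ M) (hΔ : 0 < Δ)
    (𝒢 : Set Slot) (h𝒢 : 𝒢 ⊆ elasticSlots m M Δ) (h𝒢ne : 𝒢.Nonempty) :
    -- the size of the ratio (equality occurs for `m = M`)
    (pursuitRatio (M / m) ≤ Real.log (M / m) + 4 / 3 ∧
      (m < M → pursuitRatio (M / m) < Real.log (M / m) + 4 / 3)) ∧
    -- CR-Pursuit with any parameter `π ≥ 1` can be carried out, with the per-slot bound
    (∀ π : ℝ, 1 ≤ π →
      (∃ A : OnlineAlgorithm, IsCRPursuit 𝒢 Δ π A) ∧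
      (∀ A : OnlineAlgorithm, IsCRPursuit 𝒢 Δ π A →
        ∀ (σ : ℕ → Slot) (T : ℕ), IsInput 𝒢 σ T → ∀ t < T,
          A.action σ t ≤ 2 * (1 + Real.sqrt (1 - 1 / π))⁻¹ *
            ((σ t).revenue (A.action σ t) / (σ t).price))) ∧
    -- CR-Pursuit with the parameter `π̄ ≥ 1` is feasible and `π̄`-competitive
    1 ≤ pursuitRatio (M / m) ∧
    (∀ A : OnlineAlgorithm, IsCRPursuit 𝒢 Δ (pursuitRatio (M / m)) A →
      IsFeasible 𝒢 Δ A ∧ IsCompetitive 𝒢 Δ (pursuitRatio (M / m)) A) := by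
  have hM : 0 < M := hm.trans_le hmM
  have hθ : 1 ≤ M / m := (one_le_div hm).2 hmM
  have hπ := one_le_pursuitRatio hθ
  refine ⟨⟨pursuitRatio_le hθ, fun h => pursuitRatio_lt ((one_lt_div hm).2 h)⟩,
    fun π hπ => ⟨⟨crPursuit Δ π, isCRPursuit_crPursuit h𝒢 hM.le hΔ.le hπ⟩,
      fun A hA σ T hσ t ht => hA.action_le h𝒢 hm hM.le hΔ.le hπ hσ ht⟩, hπ, fun A hA => ?_⟩
  have hsum : ∀ (σ : ℕ → Slot) (T : ℕ), IsInput 𝒢 σ T →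
      ∑ t ∈ Finset.range T, A.action σ t ≤ Δ :=
    fun σ T hσ => hA.sum_action_le h𝒢 hm hmM hΔ.le hσ
  have hopt : ∀ (σ : ℕ → Slot) (T : ℕ), IsInput 𝒢 σ T → 0 < opt Δ σ T :=
    fun σ T hσ => opt_pos hm hM.le hΔ hσ.1 fun t ht => h𝒢 (hσ.2 t ht)
  have hratio : ∀ (σ : ℕ → Slot) (T : ℕ), IsInput 𝒢 σ T →
      opt Δ σ T / A.totalRevenue σ T = pursuitRatio (M / m) := by
    intro σ T hσ
    have := (hopt σ T hσ).ne'
    rw [hA.totalRevenue_eq hΔ.le hσ]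
    field_simp
  refine ⟨iSup_le fun σ => iSup_le fun T => iSup_le fun hσ => EReal.coe_le_coe (hsum σ T hσ),
    fun σ T hσ => ⟨fun t ht => (hA σ T hσ t ht).1.1, hsum σ T hσ, ?_⟩, ?_, ?_⟩
  · rw [hA.totalRevenue_eq hΔ.le hσ]
    exact mul_pos (by positivity) (hopt σ T hσ)
  · obtain ⟨s, hs⟩ := h𝒢ne
    -- All inputs have the same ratio, so any single slot attains the maximum.
    have hin : IsInput 𝒢 (fun _ => s) 1 := ⟨le_rfl, fun _ _ => hs⟩
    exact ⟨_, 1, hin, (hratio _ _ hin).symm⟩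
  · rintro _ ⟨σ, T, hσ, rfl⟩
    exact (hratio σ T hσ).le
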